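/- Let $\alpha\ge-\tfrac12$, $d_\alpha=2\alpha+2$ and $d\mu_\alpha(x)=\frac{|x|^{2\alpha+1}}{2^{\alpha+1}\Gamma(\alpha+1)}\,dx$ on $\mathbb R$. Let $B(0,r)=(-r,r)$. Let $\tau_x f(y)=\int_{\mathbb R} f\,d\nu_{x,y}$ be the Dunkl translation. For $\alpha=-\frac12$ it is the ordinary translation $\tau_xf(y)=f(x+y)$. For $\alpha>-\frac12$ it is given by $\nu_{x,0}=\delta_x$, $\nu_{0,y}=\delta_y$ and, for $x,y\neq0$, by the signed measure $d\nu_{x,y}(z)=W_\alpha(x,y,z)\,d\mu_\alpha(z)$, where $$W_\alpha(x,y,z)=(1-\sigma_{x,y,z}+\sigma_{z,x,y}+\sigma_{z,y,x})\,\kappa_\alpha(|x|,|y|,|z|),\qquad \sigma_{x,y,z}=\frac{x^2+y^2-z^2}{2xy}\ \text{ if } x,y\ne0,\quad \sigma_{x,y,z}=0\ \text{ otherwise},$$ $$\kappa_\alpha(|x|,|y|,|z|)=\frac{\Gamma(\alpha+1)^2}{2^{\alpha-1}\sqrt\pi\,\Gamma(\alpha+\frac12)}\cdot\frac{\big([(|x|+|y|)^2-z^2][z^2-(|x|-|y|)^2]\big)^{\alpha-1/2}}{|xyz|^{2\alpha}}$$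 if $\big||x|-|y|\big|\le|z|\le|x|+|y|$, and $\kappa_\alpha=0$ otherwise. For $1\le p<\infty$ and $\phi:(0,\infty)\to(0,\infty)$, the generalized Dunkl-type Morrey space $L^{p,\phi}(\mathbb R,d\mu_\alpha)$ consists of the locally $p$-integrable (with respect to $\mu_\alpha$) functions $f:\mathbb R\to\mathbb C$ such that $$\|f\|_{L^{p,\phi}}=\sup_{x\in\mathbb R,\ r>0}\frac1{\phi(r)}\Big(\frac1{r^{d_\alpha}}\int_{B(0,r)}\tau_x(|f|^p)(y)\,d\mu_\alpha(y)\Big)^{1/p}<\infty ,$$ where it is understood that, for every $x$, the integral defining $\tau_x(|f|^p)(y)$ converges absolutely for $\mu_\alpha$-almost every $y$ and that $\tau_x(|f|^p)$ is $\mu_\alpha$-integrable on every $B(0,r)$. The Dunkl-type Bessel–Riesz kernel is $$K^\alpha_{\beta,\gamma}(x)=\frac{|x|^{\beta-d_\alpha}}{(1+|x|)^\gamma}.$$ **Lemma.** Let $s\ge1$, $\gamma>0$ and $d_\alpha-\frac{d_\alpha}{s}<\beta<d_\alpha$. (a) If $\omega:(0,\infty)\to(0,\infty)$ and there is a constant $C>0$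 with $\omega(r)\ge C r^{\beta-d_\alpha}$ for all $r>0$, then $K^\alpha_{\beta,\gamma}\in L^{s,\omega}(\mathbb R,d\mu_\alpha)$. (b) For every $x\in\mathbb R$, the integral defining $\tau_x\big((K^\alpha_{\beta,\gamma})^s\big)(y)$ converges absolutely for $\mu_\alpha$-almost every $y$, the function $\tau_x\big((K^\alpha_{\beta,\gamma})^s\big)$ is $\mu_\alpha$-integrable on every $B(0,R)$, and there is a constant $C>0$, depending only on $\alpha,\beta,\gamma,s$, such that for all $x\in\mathbb R$ and $R>0$ $$\Big(\int_{B(0,R)}\tau_x\big((K^\alpha_{\beta,\gamma})^s\big)(y)\,d\mu_\alpha(y)\Big)^{1/s}\le C\,R^{\beta-d_\alpha+d_\alpha/s}.$$ -/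

import Mathlib

open MeasureTheory

/-- The homogeneous dimension `d_α = 2α + 2`. -/
noncomputable def dunklDim (α : ℝ) : ℝ := 2 * α + 2

/-- The weighted measure `dμ_α(x) = (2 ^ (α + 1) Γ(α + 1))⁻¹ |x| ^ (2α + 1) dx` on `ℝ`. -/
noncomputable def dunklMeasure (α : ℝ) : Measure ℝ :=
  volume.withDensity fun x =>
    ENNReal.ofReal ((2 ^ (α + 1) * Real.Gamma (α + 1))⁻¹ * |x| ^ (2 * α + 1))

/-- `σ_{x,y,z} = (x² + y² - z²) / (2xy)` if `x, y ≠ 0`, and `0` otherwise. -/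
noncomputable def dunklSigma (x y z : ℝ) : ℝ :=
  open Classical in
  if x ≠ 0 ∧ y ≠ 0 then (x ^ 2 + y ^ 2 - z ^ 2) / (2 * x * y) else 0

/-- The Bessel kernel `κ_α(|x|, |y|, |z|)`, supported in `||x| - |y|| ≤ |z| ≤ |x| + |y|`. -/
noncomputable def besselKappa (α x y z : ℝ) : ℝ :=
  open Classical in
  if |z| ∈ Set.Icc |(|x| - |y|)| (|x| + |y|) then
    (Real.Gamma (α + 1) ^ 2 / (2 ^ (α - 1) * Real.sqrt Real.pi * Real.Gamma (α + 1 / 2))) *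
      ((((|x| + |y|) ^ 2 - z ^ 2) * (z ^ 2 - (|x| - |y|) ^ 2)) ^ (α - 1 / 2)
        / |x * y * z| ^ (2 * α))
  else 0

/-- The signed kernel `W_α(x, y, z)` of the Dunkl translation (for `α > -1/2`). -/
noncomputable def dunklW (α x y z : ℝ) : ℝ :=
  (1 - dunklSigma x y z + dunklSigma z x y + dunklSigma z y x) * besselKappa α x y z

/-- The Dunkl translation `τ_x f (y) = ∫ f dν_{x,y}`, where `ν_{x,y}` is `W_α(x, y, ·) dμ_α`
if `x, y ≠ 0`, the point mass at `y` if `x = 0`, and the point mass at `x` if `y = 0`.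
For `α = -1/2` the Dunkl operator is `d/dx`, the density `W_α` degenerates, and `ν_{x,y}` is the
point mass at `x + y`. -/
noncomputable def dunklTranslation (α x : ℝ) (f : ℝ → ℝ) (y : ℝ) : ℝ :=
  open Classical in
  if α = -1 / 2 then f (x + y)
  else if x = 0 then f y
  else if y = 0 then f x
  else ∫ z, f z * dunklW α x y z ∂(dunklMeasure α)

/-- The integral defining `τ_x f (y)` converges absolutely (nothing is required when `ν_{x,y}` is a
point mass). -/
def HasDunklTranslation (α x : ℝ) (f : ℝ → ℝ) (y : ℝ) : Prop :=
  α = -1 / 2 ∨ x = 0 ∨ y = 0 ∨ Integrable (fun z => f z * dunklW α x y z) (dunklMeasure α)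

/-- For every `x`, the translate `τ_x f` is given by an absolutely convergent integral at almost
every point, and it is integrable on every ball `B(0, r) = (-r, r)`. -/
def DunklTranslatable (α : ℝ) (f : ℝ → ℝ) : Prop :=
  ∀ x : ℝ, (∀ᵐ y ∂(dunklMeasure α), HasDunklTranslation α x f y) ∧
    ∀ r : ℝ, 0 < r →
      IntegrableOn (fun y => dunklTranslation α x f y) (Set.Ioo (-r) r) (dunklMeasure α)

/-- The generalized Dunkl-type Morrey norm
`sup_{x, r > 0} φ(r)⁻¹ (r ^ (-d_α) ∫_{B(0, r)} τ_x |f|^p dμ_α) ^ (1/p)`, with value in `[0, ∞]`. -/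
noncomputable def dunklMorreyNorm (α p : ℝ) (φ : ℝ → ℝ) (f : ℝ → ℂ) : ENNReal :=
  ⨆ (x : ℝ) (r : ℝ) (_ : 0 < r),
    ENNReal.ofReal (1 / φ r *
      (1 / r ^ dunklDim α *
        ∫ y in Set.Ioo (-r) r, dunklTranslation α x (fun z => ‖f z‖ ^ p) y
          ∂(dunklMeasure α)) ^ (1 / p))

/-- Membership in the generalized Dunkl-type Morrey space `L^{p,φ}(ℝ, dμ_α)`: `f` is locally
`p`-integrable, the integrals in the norm make sense, and the norm is finite. -/
def MemDunklMorrey (α p : ℝ) (φ : ℝ → ℝ) (f : ℝ → ℂ) : Prop :=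
  (∀ S : Set ℝ, IsCompact S → MemLp f (ENNReal.ofReal p) ((dunklMeasure α).restrict S)) ∧
  DunklTranslatable α (fun z => ‖f z‖ ^ p) ∧
  dunklMorreyNorm α p φ f < ⊤

/-- The Dunkl-type Bessel-Riesz kernel `K(x) = |x| ^ (β - d_α) / (1 + |x|) ^ γ`
(its value at the null point `x = 0` is immaterial). -/
noncomputable def besselRieszKernel (α β γ : ℝ) (x : ℝ) : ℝ :=
  |x| ^ (β - dunklDim α) / (1 + |x|) ^ γ

/-! Since $(1+|z|)^\gamma\ge1$, $K^s\le|z|^e$ with $e=(\beta-d_\alpha)s$, and the hypotheses on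
$\beta$ give $-d_\alpha<e\le0$. Everything then reduces to bounding
$\int_{B(0,R)}\int|z|^e\,d|\nu_{x,y}|(z)\,d\mu_\alpha(y)$ by $CR^{d_\alpha+e}$, uniformly in $x$.
Split $|z|^e\le R^e+|z|^e1_{|z|<R}$ (`ofReal_abs_rpow_le`). For $\alpha>-\frac12$,
$|W_\alpha|\le4\kappa_\alpha$, and $\kappa_\alpha$ has bounded mass in $z$
(`exists_lintegral_besselKappa_le`), hence also in $y$ by symmetry. A Schur-type argument bounds the
far part by $R^e\mu_\alpha(B(0,R))$ and the near part by $\int_{B(0,R)}|z|^e\,d\mu_\alpha$, up to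
constants; both scale like $R^{d_\alpha+e}$. For $\alpha=-\frac12$ translation invariance replaces
the kernel bounds. Taking $s$-th roots gives (b), and dividing by $r^{d_\alpha/s}\omega(r)$ gives
(a). -/

theorem dunklDensity_const_pos {α : ℝ} (hα : -1 / 2 ≤ α) :
    0 < ((2 : ℝ) ^ (α + 1) * Real.Gamma (α + 1))⁻¹ := by
  have := Real.Gamma_pos_of_pos (show 0 < α + 1 by linarith)
  positivity

/-! ### Even functions and powers against $\mu_\alpha$. -/

theorem lintegral_even {g : ℝ → ENNReal} (hg : ∀ x, g (-x) = g x) :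
    ∫⁻ x, g x = 2 * ∫⁻ x in Set.Ioi 0, g x := by
  have h : ∫⁻ x in Set.Iic 0, g x = ∫⁻ x in Set.Ioi 0, g x := by
    rw [setLIntegral_congr Iio_ae_eq_Iic.symm,
      ← (Measure.measurePreserving_neg (volume : Measure ℝ)).setLIntegral_comp_preimage_emb
        (MeasurableEquiv.neg ℝ).measurableEmbedding g (Set.Ioi 0)]
    simp [hg]
  rw [← lintegral_add_compl g measurableSet_Ioi (A := Set.Ioi 0), Set.compl_Ioi, h, two_mul]

theorem measurable_dunklDensity (α : ℝ) : Measurable fun x : ℝ =>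
    ENNReal.ofReal ((2 ^ (α + 1) * Real.Gamma (α + 1))⁻¹ * |x| ^ (2 * α + 1)) := by
  fun_prop

instance (α : ℝ) : SFinite (dunklMeasure α) := by
  unfold dunklMeasure; infer_instance

theorem lintegral_dunklMeasure_even (α : ℝ) {g : ℝ → ENNReal} (hm : Measurable g)
    (hg : ∀ x, g (-x) = g x) :
    ∫⁻ x, g x ∂(dunklMeasure α) = 2 * ∫⁻ x in Set.Ioi 0,
      ENNReal.ofReal ((2 ^ (α + 1) * Real.Gamma (α + 1))⁻¹ * x ^ (2 * α + 1)) * g x := by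
  rw [dunklMeasure, lintegral_withDensity_eq_lintegral_mul _ (measurable_dunklDensity α) hm,
    lintegral_even (by simp [hg])]
  congr 1
  refine setLIntegral_congr_fun measurableSet_Ioi fun x hx => ?_
  simp [abs_of_pos (Set.mem_Ioi.1 hx)]

/-- Homogeneity of `∫_{B(0, R)} |z| ^ e dμ_α` in `R`. -/
theorem setLIntegral_abs_rpow_dunklMeasure {α e : ℝ} (hα : -1 / 2 ≤ α) (he : -dunklDim α < e) :
    ∃ C : ℝ, 0 ≤ C ∧ ∀ R : ℝ, 0 < R →
      ∫⁻ z in Set.Ioo (-R) R, ENNReal.ofReal (|z| ^ e) ∂(dunklMeasure α) =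
        ENNReal.ofReal (C * R ^ (dunklDim α + e)) := by
  have hc := dunklDensity_const_pos hα
  set c : ℝ := ((2 : ℝ) ^ (α + 1) * Real.Gamma (α + 1))⁻¹ with hcdef
  have hd : 0 < dunklDim α + e := by linarith
  -- This is $2\int_0^1 c\,r^{d_\alpha+e-1}\,dr$, the $2$ coming from evenness.
  refine ⟨2 * (c / (dunklDim α + e)), by positivity, fun R hR => ?_⟩
  rw [← lintegral_indicator measurableSet_Ioo, lintegral_dunklMeasure_even]
  · have hfun : ∀ x : ℝ, ENNReal.ofReal (c * x ^ (2 * α + 1)) *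
        (Set.Ioo (-R) R).indicator (fun z => ENNReal.ofReal (|z| ^ e)) x =
        (Set.Ioo (-R) R).indicator
          (fun x => ENNReal.ofReal (c * x ^ (2 * α + 1)) * ENNReal.ofReal (|x| ^ e)) x :=
      fun x => by rw [Set.indicator_mul_right]
    simp_rw [← hcdef, hfun]
    rw [setLIntegral_indicator measurableSet_Ioo]
    have hset : Set.Ioo (-R) R ∩ Set.Ioi 0 = Set.Ioo 0 R := by
      ext x; simp only [Set.mem_inter_iff, Set.mem_Ioo, Set.mem_Ioi]
      constructor
      · rintro ⟨⟨_, h⟩, h'⟩; exact ⟨h', h⟩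
      · rintro ⟨h, h'⟩; exact ⟨⟨by linarith, h'⟩, h⟩
    have hexp : dunklDim α + e - 1 = 2 * α + 1 + e := by rw [dunklDim]; ring
    rw [hset, setLIntegral_congr_fun (g := fun x => ENNReal.ofReal (c * x ^ (dunklDim α + e - 1)))
      measurableSet_Ioo]
    · rw [← ofReal_integral_eq_lintegral_ofReal]
      · rw [integral_const_mul, ← integral_Ioc_eq_integral_Ioo,
          ← intervalIntegral.integral_of_le hR.le, integral_rpow (Or.inl (by linarith)),
          sub_add_cancel, Real.zero_rpow hd.ne', sub_zero,
          show (2 : ENNReal) = ENNReal.ofReal 2 by simp, ← ENNReal.ofReal_mul zero_le_two]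
        congr 1; ring
      · exact ((intervalIntegral.integrableOn_Ioo_rpow_iff hR).2 (by linarith)).const_mul c
      · filter_upwards [ae_restrict_mem measurableSet_Ioo] with x hx
        have := hx.1
        simp only [Pi.zero_apply]; positivity
    · intro x hx
      have h0 := hx.1
      simp only
      rw [← ENNReal.ofReal_mul (by positivity), abs_of_pos h0, hexp, mul_assoc,
        ← Real.rpow_add h0]
  · exact Measurable.indicator (by fun_prop) measurableSet_Ioo
  · intro x
    simp only [Set.indicator, Set.mem_Ioo, abs_neg]
    congr 1
    rw [eq_iff_iff]; constructor <;> rintro ⟨h, h'⟩ <;> constructor <;> linarith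

/-! ### Size, symmetry and mass of the kernels. -/

theorem besselKappa_nonneg {α : ℝ} (hα : -1 / 2 < α) (x y z : ℝ) : 0 ≤ besselKappa α x y z := by
  unfold besselKappa
  split_ifs with h
  · have := Real.Gamma_pos_of_pos (show 0 < α + 1 / 2 by linarith)
    have h1 : z ^ 2 ≤ (|x| + |y|) ^ 2 := by
      rw [← sq_abs z]; exact pow_le_pow_left₀ (abs_nonneg z) h.2 2
    have h2 : (|x| - |y|) ^ 2 ≤ z ^ 2 := by
      rw [← sq_abs z, ← sq_abs (|x| - |y|)]; exact pow_le_pow_left₀ (abs_nonneg _) h.1 2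
    have := Real.rpow_nonneg (mul_nonneg (sub_nonneg.2 h1) (sub_nonneg.2 h2)) (α - 1 / 2)
    positivity
  · exact le_rfl

/-- The support condition says that $|x|,|y|,|z|$ are the sides of a triangle, and by Heron's
formula the product in the numerator is 16 times its squared area. -/
theorem besselKappa_swap (α x y z : ℝ) : besselKappa α x y z = besselKappa α x z y := by
  unfold besselKappa
  have h : |z| ∈ Set.Icc |(|x| - |y|)| (|x| + |y|) ↔ |y| ∈ Set.Icc |(|x| - |z|)| (|x| + |z|) := by
    rw [Set.mem_Icc, Set.mem_Icc, abs_le (a := |x| - |y|), abs_le (a := |x| - |z|)]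
    constructor <;> rintro ⟨⟨h1, h2⟩, h3⟩ <;> refine ⟨⟨?_, ?_⟩, ?_⟩ <;> linarith
  have h' : ((|x| + |y|) ^ 2 - z ^ 2) * (z ^ 2 - (|x| - |y|) ^ 2) =
      ((|x| + |z|) ^ 2 - y ^ 2) * (y ^ 2 - (|x| - |z|) ^ 2) := by
    rw [← sq_abs z, ← sq_abs y]; ring
  simp only [h, h', mul_right_comm x y z]

/-- Law of cosines: up to sign, $\sigma$ is the cosine of an angle of that triangle when $x,y\ne0$.
-/
theorem abs_dunklSigma_le_one {x y z : ℝ} (h1 : |(|x| - |y|)| ≤ |z|) (h2 : |z| ≤ |x| + |y|) :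
    |dunklSigma x y z| ≤ 1 := by
  unfold dunklSigma
  split_ifs with h
  · have hx := abs_pos.2 h.1
    have hy := abs_pos.2 h.2
    have h3 := pow_le_pow_left₀ (abs_nonneg z) h2 2
    have h4 := pow_le_pow_left₀ (abs_nonneg _) h1 2
    rw [sq_abs] at h4
    rw [abs_div, div_le_one (by simp [h]), ← sq_abs x, ← sq_abs y, ← sq_abs z, abs_mul, abs_mul,
      abs_two, abs_le]
    constructor <;> nlinarith
  · simp

theorem abs_dunklW_le {α : ℝ} (hα : -1 / 2 < α) (x y z : ℝ) :
    |dunklW α x y z| ≤ 4 * besselKappa α x y z := by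
  rw [dunklW, abs_mul, abs_of_nonneg (besselKappa_nonneg hα x y z)]
  by_cases h : |z| ∈ Set.Icc |(|x| - |y|)| (|x| + |y|)
  · have h0 := h.2
    obtain ⟨h1, h2⟩ := abs_le.1 h.1
    refine mul_le_mul_of_nonneg_right ?_ (besselKappa_nonneg hα x y z)
    have ha := abs_le.1 (abs_dunklSigma_le_one h.1 h.2)
    have hb := abs_le.1 (abs_dunklSigma_le_one (x := z) (y := x) (z := y)
      (abs_le.2 ⟨by linarith, by linarith⟩) (by linarith))
    have hc := abs_le.1 (abs_dunklSigma_le_one (x := z) (y := y) (z := x)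
      (abs_le.2 ⟨by linarith, by linarith⟩) (by linarith))
    exact abs_le.2 ⟨by linarith, by linarith⟩
  · simp [besselKappa, h]

theorem measurable_besselKappa (α x : ℝ) :
    Measurable fun p : ℝ × ℝ => besselKappa α x p.1 p.2 := by
  unfold besselKappa
  refine Measurable.ite ?_ (by fun_prop) measurable_const
  exact (measurableSet_le (f := fun p : ℝ × ℝ => |(|x| - |p.1|)|) (g := fun p => |p.2|)
    (by fun_prop) (by fun_prop)).inter (measurableSet_le (f := fun p : ℝ × ℝ => |p.2|)
      (g := fun p => |x| + |p.1|) (by fun_prop) (by fun_prop))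

theorem measurable_dunklSigma {ι : Type*} [MeasurableSpace ι] {f g h : ι → ℝ} (hf : Measurable f)
    (hg : Measurable g) (hh : Measurable h) :
    Measurable fun p => dunklSigma (f p) (g p) (h p) := by
  unfold dunklSigma
  refine Measurable.ite ?_ (by fun_prop) measurable_const
  exact ((hf (measurableSet_singleton 0)).compl).inter ((hg (measurableSet_singleton 0)).compl)

theorem measurable_dunklW (α x : ℝ) : Measurable fun p : ℝ × ℝ => dunklW α x p.1 p.2 := by
  unfold dunklW
  refine Measurable.mul (((measurable_const.sub ?_).add ?_).add ?_) (measurable_besselKappa α x) <;>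
  exact measurable_dunklSigma (by fun_prop) (by fun_prop) (by fun_prop)

theorem integrableOn_Ioo_beta {u : ℝ} (hu : -1 < u) :
    IntegrableOn (fun t : ℝ => (t * (1 - t)) ^ u) (Set.Ioo 0 1) := by
  have h := (Complex.betaIntegral_convergent (u := ((u + 1 : ℝ) : ℂ)) (v := ((u + 1 : ℝ) : ℂ))
    (by simpa using by linarith) (by simpa using by linarith)).norm
  rw [intervalIntegrable_iff_integrableOn_Ioo_of_le zero_le_one] at h
  refine h.congr_fun (fun t ht => ?_) measurableSet_Ioo
  have h1 := ht.1
  have h2 : 0 < 1 - t := by linarith [ht.2]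
  have h3 : ((u + 1 : ℝ) : ℂ) - 1 = (u : ℂ) := by push_cast; ring
  simp only [h3, norm_mul]
  rw [← Complex.ofReal_one, ← Complex.ofReal_sub, Complex.norm_cpow_eq_rpow_re_of_pos h1,
    Complex.norm_cpow_eq_rpow_re_of_pos h2, Complex.ofReal_re, Real.mul_rpow h1.le h2.le]

/-- Put $t=(z^2-(a-b)^2)/(4ab)$. Then $1-t=((a+b)^2-z^2)/(4ab)$ and $dt/dz=z/(2ab)$, so the right
side is a Jacobian times a function of $t$ free of $a,b$. -/
theorem besselKappa_eq_of_mem_Ioo {α a b z : ℝ} (ha : 0 < a) (hb : 0 < b)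
    (hz : z ∈ Set.Ioo |a - b| (a + b)) :
    z ^ (2 * α + 1) * besselKappa α a b z =
      z / (2 * a * b) * ((2 * (Real.Gamma (α + 1) ^ 2 /
        (2 ^ (α - 1) * Real.sqrt Real.pi * Real.Gamma (α + 1 / 2))) * 4 ^ (2 * α - 1)) *
        ((z ^ 2 - (a - b) ^ 2) / (4 * a * b) *
          (1 - (z ^ 2 - (a - b) ^ 2) / (4 * a * b))) ^ (α - 1 / 2)) := by
  have hz0 : 0 < z := (abs_nonneg _).trans_lt hz.1
  have hm : 0 < a * b := mul_pos ha hb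
  have h1 : z ^ 2 < (a + b) ^ 2 := pow_lt_pow_left₀ hz.2 hz0.le two_ne_zero
  have h2 : (a - b) ^ 2 < z ^ 2 := by
    rw [← sq_abs (a - b)]; exact pow_lt_pow_left₀ hz.1 (abs_nonneg _) two_ne_zero
  have hmem : |z| ∈ Set.Icc |(|a| - |b|)| (|a| + |b|) := by
    rw [abs_of_pos hz0, abs_of_pos ha, abs_of_pos hb]; exact Set.Ioo_subset_Icc_self hz
  rw [besselKappa, if_pos hmem, abs_of_pos ha, abs_of_pos hb, abs_of_pos (by positivity)]
  set t : ℝ := (z ^ 2 - (a - b) ^ 2) / (4 * a * b) with ht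
  have ht0 : 0 < t := div_pos (by linarith) (by positivity)
  have ht1 : 0 < 1 - t := by
    rw [sub_pos, ht, div_lt_one (by positivity)]; nlinarith
  have hP : ((a + b) ^ 2 - z ^ 2) * (z ^ 2 - (a - b) ^ 2) =
      (4 * (a * b)) ^ (2 : ℝ) * (t * (1 - t)) := by
    have : (2 : ℝ) = ((2 : ℕ) : ℝ) := by norm_num
    rw [this, Real.rpow_natCast, ht]; field_simp; ring
  rw [hP, Real.mul_rpow (by positivity) (by positivity), ← Real.rpow_mul (by positivity),
    show 2 * (α - 1 / 2) = 2 * α - 1 by ring, Real.mul_rpow (x := 4) (by norm_num) hm.le,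
    Real.rpow_sub_one hm.ne' (2 * α), Real.mul_rpow hm.le hz0.le, Real.rpow_add_one hz0.ne']
  have e1 := (Real.rpow_pos_of_pos hm (2 * α)).ne'
  have e2 := (Real.rpow_pos_of_pos hz0 (2 * α)).ne'
  generalize (a * b) ^ (2 * α) = A at *
  generalize z ^ (2 * α) = Z at *
  generalize (t * (1 - t)) ^ (α - 1 / 2) = T at *
  generalize Real.Gamma (α + 1) ^ 2 / (2 ^ (α - 1) * √Real.pi * Real.Gamma (α + 1 / 2)) = N
  field_simp

theorem besselKappa_abs (α x y z : ℝ) : besselKappa α |x| |y| z = besselKappa α x y z := by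
  simp [besselKappa, abs_mul]

/-- The Bessel kernels `κ_α(x, y, ·)` have uniformly bounded mass. -/
theorem exists_lintegral_besselKappa_le {α : ℝ} (hα : -1 / 2 < α) :
    ∃ M : ℝ, 0 ≤ M ∧ ∀ x y : ℝ, x ≠ 0 → y ≠ 0 →
      ∫⁻ z, ENNReal.ofReal (besselKappa α x y z) ∂(dunklMeasure α) ≤ ENNReal.ofReal M := by
  have hc := dunklDensity_const_pos hα.le
  set c : ℝ := ((2 : ℝ) ^ (α + 1) * Real.Gamma (α + 1))⁻¹ with hcdef
  set K : ℝ := 2 * (Real.Gamma (α + 1) ^ 2 /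
    (2 ^ (α - 1) * Real.sqrt Real.pi * Real.Gamma (α + 1 / 2))) * 4 ^ (2 * α - 1) with hK
  -- A Beta integral independent of $x,y$, finite because $\alpha-\frac12>-1$.
  set B : ENNReal := ∫⁻ t in Set.Ioo (0 : ℝ) 1,
    ENNReal.ofReal (c * (K * (t * (1 - t)) ^ (α - 1 / 2))) with hB
  have hBfin : B ≠ ⊤ :=
    (((integrableOn_Ioo_beta (u := α - 1 / 2) (by linarith)).const_mul K).const_mul
      c).lintegral_lt_top.ne
  refine ⟨(2 * B).toReal, ENNReal.toReal_nonneg, fun x y hx hy => ?_⟩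
  rw [ENNReal.ofReal_toReal (ENNReal.mul_ne_top (by simp) hBfin)]
  simp_rw [← besselKappa_abs α x y]
  have ha : 0 < |x| := abs_pos.2 hx
  have hb : 0 < |y| := abs_pos.2 hy
  generalize |x| = a at *
  generalize |y| = b at *
  have hmk : Measurable fun z => besselKappa α a b z :=
    (measurable_besselKappa α a).comp (measurable_const.prodMk measurable_id)
  rw [lintegral_dunklMeasure_even α hmk.ennreal_ofReal fun z => by simp [besselKappa, abs_mul],
    ← hcdef]
  refine mul_le_mul_right ?_ 2
  set φ : ℝ → ℝ := fun z => (z ^ 2 - (a - b) ^ 2) / (4 * a * b) with hφ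
  have hpos : ∀ z ∈ Set.Ioo |a - b| (a + b), 0 < z := fun z hz => (abs_nonneg _).trans_lt hz.1
  have himg : φ '' Set.Ioo |a - b| (a + b) ⊆ Set.Ioo 0 1 := by
    rintro _ ⟨z, hz, rfl⟩
    have h1 : z ^ 2 < (a + b) ^ 2 := pow_lt_pow_left₀ hz.2 (hpos z hz).le two_ne_zero
    have h2 : (a - b) ^ 2 < z ^ 2 := by
      rw [← sq_abs (a - b)]; exact pow_lt_pow_left₀ hz.1 (abs_nonneg _) two_ne_zero
    refine ⟨div_pos (by linarith) (by positivity), ?_⟩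
    rw [div_lt_one (by positivity)]; nlinarith
  calc ∫⁻ z in Set.Ioi 0, ENNReal.ofReal (c * z ^ (2 * α + 1)) *
        ENNReal.ofReal (besselKappa α a b z)
      ≤ ∫⁻ z in Set.Icc |a - b| (a + b), ENNReal.ofReal (c * z ^ (2 * α + 1)) *
        ENNReal.ofReal (besselKappa α a b z) := by
        rw [← lintegral_indicator measurableSet_Ioi, ← lintegral_indicator measurableSet_Icc]
        refine lintegral_mono fun z => ?_
        by_cases hz : z ∈ Set.Ioi 0
        · rw [Set.indicator_of_mem hz]
          by_cases hz' : z ∈ Set.Icc |a - b| (a + b)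
          · rw [Set.indicator_of_mem hz']
          · have : besselKappa α a b z = 0 := by
              rw [besselKappa, if_neg]
              rwa [abs_of_pos (Set.mem_Ioi.1 hz), abs_of_pos ha, abs_of_pos hb]
            simp [this]
        · rw [Set.indicator_of_notMem hz]; exact zero_le
    _ = ∫⁻ z in Set.Ioo |a - b| (a + b), ENNReal.ofReal (c * z ^ (2 * α + 1)) *
        ENNReal.ofReal (besselKappa α a b z) := (setLIntegral_congr Ioo_ae_eq_Icc).symm
    _ = ∫⁻ z in Set.Ioo |a - b| (a + b), ENNReal.ofReal |z / (2 * a * b)| *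
        ENNReal.ofReal (c * (K * (φ z * (1 - φ z)) ^ (α - 1 / 2))) := by
        refine setLIntegral_congr_fun measurableSet_Ioo fun z hz => ?_
        have h0 := hpos z hz
        have h1 := besselKappa_eq_of_mem_Ioo (α := α) ha hb hz
        rw [← hK] at h1
        rw [← ENNReal.ofReal_mul (by positivity), ← ENNReal.ofReal_mul (abs_nonneg _),
          abs_of_pos (by positivity), mul_assoc, h1]
        congr 1; ring
    _ = ∫⁻ t in φ '' Set.Ioo |a - b| (a + b),
        ENNReal.ofReal (c * (K * (t * (1 - t)) ^ (α - 1 / 2))) := by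
        refine (lintegral_image_eq_lintegral_abs_deriv_mul measurableSet_Ioo
          (fun z _ => ?_) ?_ fun t => ENNReal.ofReal (c * (K * (t * (1 - t)) ^ (α - 1 / 2)))).symm
        · have := (((hasDerivAt_pow 2 z).sub_const ((a - b) ^ 2)).div_const (4 * a * b))
          refine HasDerivAt.hasDerivWithinAt ?_
          convert! this using 1
          field_simp; norm_num [mul_comm]
        · intro z hz w hw h
          simp only [hφ] at h
          rw [div_left_inj' (by positivity)] at h
          exact (pow_left_inj₀ (hpos z hz).le (hpos w hw).le two_ne_zero).1 (by linarith)
    _ ≤ B := lintegral_mono_set himg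

/-! ### Near/far splitting and the Schur-type estimate. -/

theorem ae_dunklMeasure_ne_zero (α : ℝ) : ∀ᵐ y ∂(dunklMeasure α), y ≠ 0 :=
  (withDensity_absolutelyContinuous _ _).ae_le (Measure.ae_ne volume 0)

theorem dunklMeasure_Ioo {α : ℝ} (hα : -1 / 2 ≤ α) :
    ∃ C : ℝ, 0 ≤ C ∧ ∀ R : ℝ, 0 < R →
      dunklMeasure α (Set.Ioo (-R) R) = ENNReal.ofReal (C * R ^ dunklDim α) := by
  obtain ⟨C, hC, h⟩ := setLIntegral_abs_rpow_dunklMeasure (e := 0) hα (by rw [dunklDim]; linarith)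
  exact ⟨C, hC, fun R hR => by simpa using h R hR⟩

theorem ofReal_abs_rpow_le {e R : ℝ} (he : e ≤ 0) (hR : 0 < R) (z : ℝ) :
    ENNReal.ofReal (|z| ^ e) ≤ ENNReal.ofReal (R ^ e) +
      (Set.Ioo (-R) R).indicator (fun z => ENNReal.ofReal (|z| ^ e)) z := by
  by_cases hz : z ∈ Set.Ioo (-R) R
  · rw [Set.indicator_of_mem hz]; exact le_add_self
  · rw [Set.indicator_of_notMem hz, add_zero]
    refine ENNReal.ofReal_le_ofReal (Real.rpow_le_rpow_of_nonpos hR ?_ he)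
    rw [Set.mem_Ioo, ← abs_lt] at hz
    exact not_lt.1 hz

/-- A kernel with both marginals at most `M` maps constants boundedly into `L^∞` and `L¹` boundedly
into `L¹`. -/
theorem setLIntegral_lintegral_add_mul_kernel_le {X : Type*} [MeasurableSpace X] {μ : Measure X}
    [SFinite μ] {k : X → X → ENNReal} (hk : Measurable (Function.uncurry k)) {M c : ENNReal}
    (h₁ : ∀ᵐ y ∂μ, ∫⁻ z, k y z ∂μ ≤ M) (h₂ : ∀ᵐ z ∂μ, ∫⁻ y, k y z ∂μ ≤ M) {g : X → ENNReal}
    (hg : Measurable g) (hc : c ≠ ⊤) (s : Set X) :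
    ∫⁻ y in s, ∫⁻ z, (c + g z) * k y z ∂μ ∂μ ≤ c * M * μ s + (∫⁻ z, g z ∂μ) * M := by
  have hkl (y : X) : Measurable fun z => k y z := hk.of_uncurry_left
  have hkr (z : X) : Measurable fun y => k y z := hk.of_uncurry_right
  have hgk : Measurable (Function.uncurry fun y z => g z * k y z) :=
    (hg.comp measurable_snd).mul hk
  have hfar : ∫⁻ y in s, ∫⁻ z, c * k y z ∂μ ∂μ ≤ c * M * μ s := by
    rw [← setLIntegral_const]
    refine lintegral_mono_ae (ae_restrict_of_ae ?_)
    filter_upwards [h₁] with y hy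
    rw [lintegral_const_mul' _ _ hc]
    exact mul_le_mul_right hy _
  have hnear : ∫⁻ y in s, ∫⁻ z, g z * k y z ∂μ ∂μ ≤ (∫⁻ z, g z ∂μ) * M := by
    -- The near part is integrated over all $y$, so that Tonelli leaves the full marginal in $y$.
    refine (setLIntegral_le_lintegral _ _).trans ?_
    rw [lintegral_lintegral_swap hgk.aemeasurable, ← lintegral_mul_const _ hg]
    refine lintegral_mono_ae ?_
    filter_upwards [h₂] with z hz
    rw [lintegral_const_mul _ (hkr z)]
    exact mul_le_mul_right hz _
  simp_rw [add_mul, lintegral_add_left ((hkl _).const_mul c)]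
  rw [lintegral_add_left (Measurable.lintegral_prod_right (hk.const_mul c))]
  exact add_le_add hfar hnear

/-- The translate of `|z| ^ e` by the absolute value of the kernel `W_α`, integrated over a
ball. -/
theorem setLIntegral_lintegral_dunklW_le {α e : ℝ} (hα : -1 / 2 < α) (he : -dunklDim α < e)
    (he' : e ≤ 0) :
    ∃ C : ℝ, 0 ≤ C ∧ ∀ f : ℝ → ℝ, (∀ z, |f z| ≤ |z| ^ e) → ∀ x R : ℝ, x ≠ 0 → 0 < R →
      ∫⁻ y in Set.Ioo (-R) R, ∫⁻ z, ‖f z * dunklW α x y z‖ₑ ∂(dunklMeasure α) ∂(dunklMeasure α) ≤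
        ENNReal.ofReal (C * R ^ (dunklDim α + e)) := by
  obtain ⟨C₀, hC₀, hvol⟩ := dunklMeasure_Ioo hα.le
  obtain ⟨C₁, hC₁, hpow⟩ := setLIntegral_abs_rpow_dunklMeasure hα.le he
  obtain ⟨M, hM, hκ⟩ := exists_lintegral_besselKappa_le hα
  refine ⟨4 * M * (C₀ + C₁), by positivity, fun f hf x R hx hR => ?_⟩
  set μ := dunklMeasure α
  set k : ℝ → ℝ → ENNReal := fun y z => ENNReal.ofReal (4 * besselKappa α x y z) with hk
  set g : ℝ → ENNReal := (Set.Ioo (-R) R).indicator fun z => ENNReal.ofReal (|z| ^ e) with hg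
  have hkm : Measurable (Function.uncurry k) :=
    ((measurable_besselKappa α x).const_mul 4).ennreal_ofReal
  have hgm : Measurable g := Measurable.indicator (by fun_prop) measurableSet_Ioo
  have hmass : ∀ y, y ≠ 0 → ∫⁻ z, k y z ∂μ ≤ ENNReal.ofReal (4 * M) := fun y hy => by
    simp only [hk, ENNReal.ofReal_mul (zero_le_four (α := ℝ))]
    rw [lintegral_const_mul' _ _ ENNReal.ofReal_ne_top]
    exact mul_le_mul_right (hκ x y hx hy) _
  have hmass' : ∀ z, z ≠ 0 → ∫⁻ y, k y z ∂μ ≤ ENNReal.ofReal (4 * M) := fun z hz => by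
    simp only [hk, besselKappa_swap α x _ z]
    exact hmass z hz
  have hpt : ∀ y z, ‖f z * dunklW α x y z‖ₑ ≤ (ENNReal.ofReal (R ^ e) + g z) * k y z := by
    intro y z
    rw [enorm_mul, Real.enorm_eq_ofReal_abs, Real.enorm_eq_ofReal_abs]
    exact mul_le_mul' ((ENNReal.ofReal_le_ofReal (hf z)).trans (ofReal_abs_rpow_le he' hR z))
      (ENNReal.ofReal_le_ofReal (abs_dunklW_le hα x y z))
  have hne := ae_dunklMeasure_ne_zero α
  calc _ ≤ ∫⁻ y in Set.Ioo (-R) R, ∫⁻ z, (ENNReal.ofReal (R ^ e) + g z) * k y z ∂μ ∂μ :=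
        lintegral_mono fun y => lintegral_mono (hpt y)
    _ ≤ ENNReal.ofReal (R ^ e) * ENNReal.ofReal (4 * M) * μ (Set.Ioo (-R) R) +
        (∫⁻ z, g z ∂μ) * ENNReal.ofReal (4 * M) :=
        setLIntegral_lintegral_add_mul_kernel_le hkm (hne.mono hmass) (hne.mono hmass') hgm
          ENNReal.ofReal_ne_top _
    _ = _ := by
        rw [hg, lintegral_indicator measurableSet_Ioo, hpow R hR, hvol R hR,
          ← ENNReal.ofReal_mul (by positivity), ← ENNReal.ofReal_mul (by positivity),
          ← ENNReal.ofReal_mul (by positivity), ← ENNReal.ofReal_add (by positivity)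
          (by positivity), Real.rpow_add hR]
        congr 1; ring

/-! ### Ordinary translation, $\alpha=-\frac12$. -/

theorem lintegral_comp_add_left_dunklMeasure_neg_half {α : ℝ} (hα : α = -1 / 2) (x : ℝ)
    (h : ℝ → ENNReal) :
    ∫⁻ y, h (x + y) ∂(dunklMeasure α) = ∫⁻ y, h y ∂(dunklMeasure α) := by
  have : 2 * α + 1 = 0 := by rw [hα]; norm_num
  simp only [dunklMeasure, this, Real.rpow_zero, withDensity_const, lintegral_smul_measure,
    lintegral_add_left_eq_self]

theorem setLIntegral_enorm_comp_add_le {α e : ℝ} (hα : α = -1 / 2) (he : -dunklDim α < e)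
    (he' : e ≤ 0) :
    ∃ C : ℝ, 0 ≤ C ∧ ∀ f : ℝ → ℝ, (∀ z, |f z| ≤ |z| ^ e) → ∀ x R : ℝ, 0 < R →
      ∫⁻ y in Set.Ioo (-R) R, ‖f (x + y)‖ₑ ∂(dunklMeasure α) ≤
        ENNReal.ofReal (C * R ^ (dunklDim α + e)) := by
  obtain ⟨C₀, hC₀, hvol⟩ := dunklMeasure_Ioo hα.ge
  obtain ⟨C₁, hC₁, hpow⟩ := setLIntegral_abs_rpow_dunklMeasure hα.ge he
  refine ⟨C₀ + C₁, by positivity, fun f hf x R hR => ?_⟩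
  set μ := dunklMeasure α
  set g : ℝ → ENNReal := (Set.Ioo (-R) R).indicator fun z => ENNReal.ofReal (|z| ^ e) with hg
  calc _ ≤ ∫⁻ y in Set.Ioo (-R) R, (ENNReal.ofReal (R ^ e) + g (x + y)) ∂μ :=
        lintegral_mono fun y => by
          rw [Real.enorm_eq_ofReal_abs]
          exact (ENNReal.ofReal_le_ofReal (hf _)).trans (ofReal_abs_rpow_le he' hR _)
    _ = ENNReal.ofReal (R ^ e) * μ (Set.Ioo (-R) R) + ∫⁻ y in Set.Ioo (-R) R, g (x + y) ∂μ := by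
        rw [lintegral_add_left measurable_const, setLIntegral_const]
    _ ≤ ENNReal.ofReal (R ^ e) * μ (Set.Ioo (-R) R) + ∫⁻ y, g y ∂μ := by
        rw [← lintegral_comp_add_left_dunklMeasure_neg_half hα x g]
        exact add_le_add_right (setLIntegral_le_lintegral _ _) _
    _ = _ := by
        rw [hvol R hR, hg, lintegral_indicator measurableSet_Ioo, hpow R hR,
          ← ENNReal.ofReal_mul (by positivity), ← ENNReal.ofReal_add (by positivity)
          (by positivity), Real.rpow_add hR]
        congr 1; ring

/-! ### Translates of functions dominated by a power. -/

theorem measurable_dunklTranslation (α x : ℝ) {f : ℝ → ℝ} (hf : Measurable f) :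
    Measurable (dunklTranslation α x f) := by
  unfold dunklTranslation
  by_cases hα : α = -1 / 2
  · simp only [if_pos hα]; fun_prop
  by_cases hx : x = 0
  · simp only [if_neg hα, if_pos hx]; exact hf
  simp only [if_neg hα, if_neg hx]
  refine Measurable.ite (measurableSet_singleton 0) measurable_const ?_
  exact (StronglyMeasurable.integral_prod_right (f := fun y z => f z * dunklW α x y z)
    ((hf.comp measurable_snd).mul (measurable_dunklW α x)).stronglyMeasurable).measurable

theorem setLIntegral_enorm_dunklTranslation_le {α e : ℝ} (hα : -1 / 2 ≤ α)
    (he : -dunklDim α < e) (he' : e ≤ 0) :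
    ∃ C : ℝ, 0 < C ∧ ∀ f : ℝ → ℝ, (∀ z, |f z| ≤ |z| ^ e) → ∀ x R : ℝ, 0 < R →
      ∫⁻ y in Set.Ioo (-R) R, ‖dunklTranslation α x f y‖ₑ ∂(dunklMeasure α) ≤
        ENNReal.ofReal (C * R ^ (dunklDim α + e)) := by
  rcases hα.eq_or_lt with h | h
  · obtain ⟨C, hC, hle⟩ := setLIntegral_enorm_comp_add_le h.symm he he'
    refine ⟨C + 1, by positivity, fun f hf x R hR => ?_⟩
    simp only [dunklTranslation, if_pos h.symm]
    refine (hle f hf x R hR).trans (ENNReal.ofReal_le_ofReal ?_)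
    gcongr; linarith
  · obtain ⟨C, hC, hle⟩ := setLIntegral_lintegral_dunklW_le h he he'
    obtain ⟨C₁, hC₁, hpow⟩ := setLIntegral_abs_rpow_dunklMeasure hα he
    -- `C₁` serves $x=0$, where the translate is `f` itself, and `C` serves $x\ne0$; the $1$ makes
    -- the constant strictly positive.
    refine ⟨C + C₁ + 1, by positivity, fun f hf x R hR => ?_⟩
    simp only [dunklTranslation, if_neg h.ne']
    by_cases hx : x = 0
    · simp only [if_pos hx]
      calc _ ≤ ∫⁻ y in Set.Ioo (-R) R, ENNReal.ofReal (|y| ^ e) ∂(dunklMeasure α) :=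
            lintegral_mono fun y => by
              rw [Real.enorm_eq_ofReal_abs]; exact ENNReal.ofReal_le_ofReal (hf y)
        _ = _ := hpow R hR
        _ ≤ _ := by
            apply ENNReal.ofReal_le_ofReal
            gcongr; linarith
    · simp only [if_neg hx]
      calc _ ≤ ∫⁻ y in Set.Ioo (-R) R, ∫⁻ z, ‖f z * dunklW α x y z‖ₑ ∂(dunklMeasure α)
              ∂(dunklMeasure α) := by
            refine lintegral_mono_ae (ae_restrict_of_ae ?_)
            filter_upwards [ae_dunklMeasure_ne_zero α] with y hy
            rw [if_neg hy]
            exact enorm_integral_le_lintegral_enorm _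
        _ ≤ _ := hle f hf x R hx hR
        _ ≤ _ := by
            apply ENNReal.ofReal_le_ofReal
            gcongr; linarith

/-- For $\alpha>-\frac12$ and $x\ne0$ the double integral over each ball is finite, so the inner one
is finite almost everywhere there; countably many balls cover the line. -/
theorem dunklTranslatable_of_abs_le {α e : ℝ} (hα : -1 / 2 ≤ α) (he : -dunklDim α < e)
    (he' : e ≤ 0) {f : ℝ → ℝ} (hfm : Measurable f) (hf : ∀ z, |f z| ≤ |z| ^ e) :
    DunklTranslatable α f := by
  refine fun x => ⟨?_, fun r hr => ⟨(measurable_dunklTranslation α x hfm).aestronglyMeasurable, ?_⟩⟩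
  · rcases hα.eq_or_lt with h | h
    · exact Filter.Eventually.of_forall fun y => Or.inl h.symm
    by_cases hx : x = 0
    · exact Filter.Eventually.of_forall fun y => Or.inr (Or.inl hx)
    obtain ⟨C, -, hle⟩ := setLIntegral_lintegral_dunklW_le h he he'
    have hm : Measurable (Function.uncurry fun y z => f z * dunklW α x y z) :=
      (hfm.comp measurable_snd).mul (measurable_dunklW α x)
    have hcover : (⋃ n : ℕ, Set.Ioo (-((n : ℝ) + 1)) ((n : ℝ) + 1)) = Set.univ := by
      refine Set.eq_univ_of_forall fun y => Set.mem_iUnion.2 ?_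
      obtain ⟨n, hn⟩ := exists_nat_gt |y|
      exact ⟨n, abs_lt.1 (hn.trans (lt_add_one _))⟩
    rw [← Measure.restrict_univ (μ := dunklMeasure α), ← hcover, ae_restrict_iUnion_iff]
    intro n
    have hfin := (hle f hf x (n + 1) hx (by positivity)).trans_lt ENNReal.ofReal_lt_top
    filter_upwards [ae_lt_top (Measurable.lintegral_prod_right hm.enorm) hfin.ne] with y hy
    exact Or.inr (Or.inr (Or.inr
      ⟨(hm.comp (measurable_const.prodMk measurable_id)).aestronglyMeasurable, hy⟩))
  · obtain ⟨C, -, hle⟩ := setLIntegral_enorm_dunklTranslation_le hα he he'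
    exact (hle f hf x r hr).trans_lt ENNReal.ofReal_lt_top

theorem abs_setIntegral_dunklTranslation_le {α e : ℝ} (hα : -1 / 2 ≤ α)
    (he : -dunklDim α < e) (he' : e ≤ 0) :
    ∃ C : ℝ, 0 < C ∧ ∀ f : ℝ → ℝ, (∀ z, |f z| ≤ |z| ^ e) → ∀ x R : ℝ, 0 < R →
      |∫ y in Set.Ioo (-R) R, dunklTranslation α x f y ∂(dunklMeasure α)| ≤
        C * R ^ (dunklDim α + e) := by
  obtain ⟨C, hC, hle⟩ := setLIntegral_enorm_dunklTranslation_le hα he he'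
  refine ⟨C, hC, fun f hf x R hR => ?_⟩
  rw [← ENNReal.ofReal_le_ofReal_iff (by positivity), ← Real.enorm_eq_ofReal_abs]
  exact (enorm_integral_le_lintegral_enorm _).trans (hle f hf x R hR)

/-! ### The Bessel–Riesz kernel. -/

theorem besselRieszKernel_nonneg (α β γ z : ℝ) : 0 ≤ besselRieszKernel α β γ z := by
  unfold besselRieszKernel; positivity

theorem measurable_besselRieszKernel (α β γ : ℝ) : Measurable (besselRieszKernel α β γ) := by
  unfold besselRieszKernel; fun_prop

theorem abs_besselRieszKernel_rpow_le {γ s : ℝ} (hγ : 0 ≤ γ) (hs : 0 ≤ s) (α β z : ℝ) :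
    |besselRieszKernel α β γ z ^ s| ≤ |z| ^ ((β - dunklDim α) * s) := by
  have h0 := besselRieszKernel_nonneg α β γ z
  rw [abs_of_nonneg (by positivity), Real.rpow_mul (abs_nonneg z)]
  refine Real.rpow_le_rpow h0 (div_le_self (by positivity) ?_) hs
  exact Real.one_le_rpow (by linarith [abs_nonneg z]) hγ

theorem memLp_besselRieszKernel {α β γ s R : ℝ} (hα : -1 / 2 ≤ α) (hγ : 0 ≤ γ) (hs : 0 < s)
    (he : -dunklDim α < (β - dunklDim α) * s) (hR : 0 < R) :
    MemLp (fun x => (besselRieszKernel α β γ x : ℂ)) (ENNReal.ofReal s)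
      ((dunklMeasure α).restrict (Set.Ioo (-R) R)) := by
  obtain ⟨C, -, hpow⟩ := setLIntegral_abs_rpow_dunklMeasure hα he
  have hm : Measurable fun x => (besselRieszKernel α β γ x : ℂ) :=
    Complex.measurable_ofReal.comp (measurable_besselRieszKernel α β γ)
  rw [← integrable_norm_rpow_iff hm.aestronglyMeasurable (by simpa using hs) ENNReal.ofReal_ne_top,
    ENNReal.toReal_ofReal hs.le]
  refine ⟨(hm.norm.pow_const s).aestronglyMeasurable, ?_⟩
  calc _ ≤ ∫⁻ z in Set.Ioo (-R) R, ENNReal.ofReal (|z| ^ ((β - dunklDim α) * s))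
        ∂(dunklMeasure α) := lintegral_mono fun z => by
          simp only [Real.enorm_eq_ofReal_abs,
            Complex.norm_of_nonneg (besselRieszKernel_nonneg α β γ z)]
          exact ENNReal.ofReal_le_ofReal (abs_besselRieszKernel_rpow_le hγ hs.le α β z)
    _ = _ := hpow R hR
    _ < ⊤ := ENNReal.ofReal_lt_top

theorem mainTheorem9 (α β γ s : ℝ) (hα : -1 / 2 ≤ α) (hs : 1 ≤ s) (hγ : 0 < γ)
    (hβ : dunklDim α - dunklDim α / s < β) (hβ' : β < dunklDim α) :
    (∀ ω : ℝ → ℝ, (∀ r, 0 < r → 0 < ω r) →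
      (∃ C : ℝ, 0 < C ∧ ∀ r, 0 < r → C * r ^ (β - dunklDim α) ≤ ω r) →
      MemDunklMorrey α s ω (fun x => (besselRieszKernel α β γ x : ℂ))) ∧
    (DunklTranslatable α (fun z => besselRieszKernel α β γ z ^ s) ∧
      ∃ C : ℝ, 0 < C ∧ ∀ x R : ℝ, 0 < R →
        (∫ y in Set.Ioo (-R) R,
            dunklTranslation α x (fun z => besselRieszKernel α β γ z ^ s) y
              ∂(dunklMeasure α)) ^ (1 / s)
          ≤ C * R ^ (β - dunklDim α + dunklDim α / s)) := by
  have hs0 : 0 < s := by linarith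
  -- The lower bound on $\beta$ is exactly local integrability of $|z|^{(\beta-d_\alpha)s}$.
  have he : -dunklDim α < (β - dunklDim α) * s := by
    have := mul_lt_mul_of_pos_right hβ hs0
    rw [sub_mul, div_mul_cancel₀ _ hs0.ne'] at this
    linarith
  have he' : (β - dunklDim α) * s ≤ 0 :=
    mul_nonpos_of_nonpos_of_nonneg (by linarith) hs0.le
  have hf := abs_besselRieszKernel_rpow_le hγ.le hs0.le α β
  have htrans : DunklTranslatable α (fun z => besselRieszKernel α β γ z ^ s) :=
    dunklTranslatable_of_abs_le hα he he' ((measurable_besselRieszKernel α β γ).pow_const s) hf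
  obtain ⟨C, hC, hle⟩ := abs_setIntegral_dunklTranslation_le hα he he'
  -- As $W_\alpha$ is signed, the absolute value is kept; $t^{1/s}\le|t|^{1/s}$ for every real $t$,
  -- so the sign of the integral is never needed.
  have hroot : ∀ x R : ℝ, 0 < R →
      |∫ y in Set.Ioo (-R) R, dunklTranslation α x (fun z => besselRieszKernel α β γ z ^ s) y
        ∂(dunklMeasure α)| ^ (1 / s) ≤
        C ^ (1 / s) * R ^ (β - dunklDim α + dunklDim α / s) := fun x R hR => by
    refine (Real.rpow_le_rpow (abs_nonneg _) (hle _ hf x R hR) (by positivity)).trans_eq ?_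
    rw [Real.mul_rpow hC.le (by positivity), ← Real.rpow_mul hR.le]
    congr 2
    field_simp; ring
  refine ⟨fun ω hω ⟨c, hc, hcω⟩ => ⟨fun S hS => ?_, ?_, ?_⟩, htrans, C ^ (1 / s), by positivity,
    fun x R hR => ((le_abs_self _).trans (Real.abs_rpow_le_abs_rpow _ _)).trans (hroot x R hR)⟩
  · obtain ⟨R, hR, hSR⟩ := hS.isBounded.subset_ball_lt 0 0
    rw [Real.ball_eq_Ioo, zero_sub, zero_add] at hSR
    exact (memLp_besselRieszKernel hα hγ.le hs0 he hR).mono_measure (Measure.restrict_mono_set _ hSR)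
  · simpa only [Complex.norm_of_nonneg (besselRieszKernel_nonneg α β γ _)] using htrans
  · simp only [dunklMorreyNorm, Complex.norm_of_nonneg (besselRieszKernel_nonneg α β γ _)]
    -- The powers of $r$ cancel:
    -- $r^{-(\beta-d_\alpha)}\,r^{-d_\alpha/s}\,r^{\beta-d_\alpha+d_\alpha/s}=1$.
    refine lt_of_le_of_lt (b := ENNReal.ofReal (C ^ (1 / s) / c))
      (iSup_le fun x => iSup_le fun r => iSup_le fun hr => ENNReal.ofReal_le_ofReal ?_)
      ENNReal.ofReal_lt_top
    set I := ∫ y in Set.Ioo (-r) r, dunklTranslation α x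
      (fun z => besselRieszKernel α β γ z ^ s) y ∂(dunklMeasure α) with hI
    have hωr := hω r hr
    calc 1 / ω r * (1 / r ^ dunklDim α * I) ^ (1 / s)
        ≤ 1 / (c * r ^ (β - dunklDim α)) * (r ^ (-(dunklDim α / s)) *
            (C ^ (1 / s) * r ^ (β - dunklDim α + dunklDim α / s))) := by
          have h1 : (1 / r ^ dunklDim α * I) ^ (1 / s) ≤ r ^ (-(dunklDim α / s)) *
              (C ^ (1 / s) * r ^ (β - dunklDim α + dunklDim α / s)) := by
            refine ((le_abs_self _).trans (Real.abs_rpow_le_abs_rpow _ _)).trans ?_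
            rw [abs_mul, abs_of_pos (by positivity), Real.mul_rpow (by positivity) (abs_nonneg _),
              one_div, ← Real.rpow_neg hr.le, ← Real.rpow_mul hr.le,
              show -dunklDim α * (1 / s) = -(dunklDim α / s) by ring]
            exact mul_le_mul_of_nonneg_left (hroot x r hr) (by positivity)
          refine (mul_le_mul_of_nonneg_left h1 (by positivity)).trans ?_
          exact mul_le_mul_of_nonneg_right
            (one_div_le_one_div_of_le (by positivity) (hcω r hr)) (by positivity)
      _ = C ^ (1 / s) / c := by
          rw [Real.rpow_add hr, Real.rpow_neg hr.le]
          have h1 := (Real.rpow_pos_of_pos hr (dunklDim α / s)).ne'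
          have h2 := (Real.rpow_pos_of_pos hr (β - dunklDim α)).ne'
          field_simp
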